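/- Let $k\ge 1$ be an integer and $\theta\ge 1$ a real number with $k\theta>1$ (i.e. $(k,\theta)\neq(1,1)$), and let $R=(R_{i,j})_{0\le i,j\le k-1}$ be a (row-)stochastic matrix. Consider the negative but linearly reinforced urn with $k$ colours, replacement matrix $R$ and parameter $\theta$: random row vectors $U_n=(U_{n,j})_{0\le j\le k-1}$ and random colours $Z_n$, $n\ge 0$, on a probability space, such that $U_0$ is (almost surely) a probability vector and, for all $n\ge 0$, with $\mathcal F_n=\sigma(U_0,\dots,U_n)$, $$\mathbf P(Z_n=j\mid \mathcal F_n)=\frac{\theta-\frac{U_{n,j}}{n+1}}{\sum_{i=0}^{k-1}\bigl(\theta-\frac{U_{n,i}}{n+1}\bigr)}\quad(0\le j\le k-1),\qquad U_{n+1}=U_n+\chi_{n+1}R,\qquad \chi_{n+1}=\bigl(\mathbf 1(Z_n=j)\bigr)_{0\le j\le k-1}.$$ Let $J$ be the $k\times k$ all-ones matrix, $I$ the identity matrix, $\mathbf 1=(1,\dots,1)$ the all-ones row vector, $A=\frac{\theta}{k\theta-1}J-\frac1{k\theta-1}I$, and $$\hat R=RA=\frac{1}{k\theta-1}(\theta J-R).$$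 **Theorem.** Suppose $\hat R$ is irreducible. Then the equation $$(\theta\mathbf 1-\mu)R=(k\theta-1)\mu$$ has a unique solution $\mu=(\mu_0,\dots,\mu_{k-1})\in\mathbb R^k$, and for every starting configuration $U_0$, $$\frac{U_{n,j}}{n+1}\longrightarrow\mu_j\quad\text{almost surely, for every } 0\le j\le k-1 .$$ In particular, the limit is uniform, that is $\mu_j=1/k$ for all $j$, if and only if $R$ is doubly stochastic. -/

import Mathlib

open MeasureTheory Filter Topology

/-- The linear decreasing weight function `w_θ(x) = θ - x`. -/
def urnWeight (θ x : ℝ) : ℝ := θ - x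

/-- The `k × k` matrix `A = θ / (kθ - 1) • J - 1 / (kθ - 1) • I`,
where `J` is the all-ones matrix. -/
noncomputable def urnA (k : ℕ) (θ : ℝ) : Matrix (Fin k) (Fin k) ℝ :=
  (θ / (k * θ - 1)) • Matrix.of (fun _ _ => (1 : ℝ))
    - (1 / (k * θ - 1)) • (1 : Matrix (Fin k) (Fin k) ℝ)

/-- The matrix `R̂ = R A`. -/
noncomputable def urnRhat {k : ℕ} (R : Matrix (Fin k) (Fin k) ℝ) (θ : ℝ) :
    Matrix (Fin k) (Fin k) ℝ :=
  R * urnA k θ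

/-- For a (row-)stochastic matrix `R`, `R̂ = (θ J - R) / (kθ - 1)`. -/
theorem urnRhat_apply {k : ℕ} {R : Matrix (Fin k) (Fin k) ℝ} (θ : ℝ)
    (hR : R ∈ Matrix.rowStochastic ℝ (Fin k)) (i j : Fin k) :
    urnRhat R θ i j = (θ - R i j) / (k * θ - 1) := by
  have h : ∑ l, R i l = 1 := by
    have := congrFun hR.2 i
    simpa [Matrix.mulVec, dotProduct] using this
  have h1 : (R * Matrix.of (fun _ _ : Fin k => (1 : ℝ))) i j = 1 := by
    simpa [Matrix.mul_apply] using h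
  simp only [urnRhat, urnA, Matrix.mul_sub, Matrix.mul_smul, Matrix.mul_one,
    Matrix.sub_apply, Matrix.smul_apply, h1, smul_eq_mul]
  ring

/-- The σ-algebra `F_n = σ(U_0, …, U_n)` generated by the configurations up to time `n`. -/
@[reducible] def urnHistory {k : ℕ} {Ω : Type*} (U : ℕ → Ω → Fin k → ℝ) (n : ℕ) : MeasurableSpace Ω :=
  ⨆ m ≤ n, MeasurableSpace.comap (U m) inferInstance

/-- `(U, Z)` is a negative but linearly reinforced urn scheme on the probability space `(Ω, P)`,
with `k` colours, replacement matrix `R` and parameter `θ`. `U n ω j` is the amount of colour `j`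
at time `n`, and `Z n` is the colour selected in the `(n + 1)`-th draw. -/
structure IsNegReinforcedUrn {k : ℕ} {Ω : Type*} [MeasurableSpace Ω] (P : Measure Ω)
    (R : Matrix (Fin k) (Fin k) ℝ) (θ : ℝ)
    (U : ℕ → Ω → Fin k → ℝ) (Z : ℕ → Ω → Fin k) : Prop where
  measurable_config : ∀ n, Measurable (U n)
  measurable_draw : ∀ n, Measurable (Z n)
  /-- The starting configuration is a probability vector. -/
  initial : ∀ᵐ ω ∂P, U 0 ω ∈ stdSimplex ℝ (Fin k)
  /-- Given `F_n`, colour `j` is selected with probability proportional to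
  `w_θ(U_{n,j} / (n + 1))`. -/
  draw : ∀ (n : ℕ) (j : Fin k),
    P[(Z n ⁻¹' {j}).indicator (fun _ => (1 : ℝ)) | urnHistory U n] =ᵐ[P]
      fun ω => urnWeight θ (U n ω j / (n + 1)) / ∑ i, urnWeight θ (U n ω i / (n + 1))
  /-- `U_{n+1} = U_n + χ_{n+1} R`, where `χ_{n+1}` is the indicator row vector of `Z_n`. -/
  step : ∀ n : ℕ, ∀ᵐ ω ∂P,
    U (n + 1) ω = U n ω + Matrix.vecMul (fun j => if Z n ω = j then (1 : ℝ) else 0) R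

/-! ### Stationary laws and the spectral gap of an irreducible chain. -/

section Stationary

variable {ι : Type*} [Fintype ι] [DecidableEq ι] {P : Matrix ι ι ℝ}

/-! Write κ = kθ - 1 and follow the draw probabilities x_n = (θ - U_n/(n+1))/κ instead of U_n. The
total mass of U_n is n+1, so the normalising sum is constant and x_n is affine in U_n. With noise
ξ_n (the centred increment of U), the urn becomes x_{n+1} = x_n + (x_n R̂ - x_n - ξ_n/κ)/(n+2).
Negative reinforcement by R is thus a noisy flow of the Markov chain R̂, and the equation for μ says
exactly that (θ - μ)/κ is stationary of mass 1 for R̂. Irreducibility gives a unique positive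
stationary law p, so μ = θ - κp.

The noise series Σ ξ_n/(n+2) converges almost surely, by an L² martingale bound
(`ae_exists_tendsto_sum_of_martingale_diff`), so subtracting its tail leaves a deterministic
recursion for each path. There Σ w_j²/p_j is a Lyapunov function: its drift is a Dirichlet form,
strictly negative on nonzero vectors of sum zero (`exists_spectral_gap`). Neither reversibility nor
aperiodicity is needed. Since Σ 1/(n+2) diverges, the path converges to p
(`tendsto_stationary_of_recursion`). -/

theorem sum_vecMul_of_mem_rowStochastic (hP : P ∈ Matrix.rowStochastic ℝ ι) (x : ι → ℝ) :
    ∑ j, Matrix.vecMul x P j = ∑ j, x j := by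
  simp only [Matrix.vecMul, dotProduct]
  rw [Finset.sum_comm]
  simp [← Finset.mul_sum, Matrix.sum_row_of_mem_rowStochastic hP]

/-- A row-stochastic matrix has a stationary probability vector. -/
theorem exists_stationary_of_mem_rowStochastic [Nonempty ι]
    (hP : P ∈ Matrix.rowStochastic ℝ ι) :
    ∃ p : ι → ℝ, (∀ i, 0 ≤ p i) ∧ ∑ i, p i = 1 ∧ Matrix.vecMul p P = p := by
  have hdet : (P - 1).det = 0 := by
    refine Matrix.exists_mulVec_eq_zero_iff.1 ⟨1, one_ne_zero, ?_⟩
    rw [Matrix.sub_mulVec, Matrix.one_vecMul_of_mem_rowStochastic hP, Matrix.one_mulVec, sub_self]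
  obtain ⟨x, hx0, hx⟩ := Matrix.exists_vecMul_eq_zero_iff.2 hdet
  rw [Matrix.vecMul_sub, Matrix.vecMul_one, sub_eq_zero] at hx
  -- The triangle inequality gives |x| ≤ |x|P entrywise. Both sides have the same total, so equality
  -- holds and |x|, normalised, is stationary.
  have hle : ∀ j ∈ Finset.univ, |x j| ≤ Matrix.vecMul (fun i => |x i|) P j := by
    intro j _
    conv_lhs => rw [← hx]
    simp only [Matrix.vecMul, dotProduct]
    refine (Finset.abs_sum_le_sum_abs _ _).trans (Finset.sum_le_sum fun i _ => ?_)
    rw [abs_mul, abs_of_nonneg (hP.1 i j)]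
  have heq := (Finset.sum_eq_sum_iff_of_le hle).1
    (sum_vecMul_of_mem_rowStochastic hP fun i => |x i|).symm
  obtain ⟨i₀, hi₀⟩ := Function.ne_iff.1 hx0
  have hs : 0 < ∑ i, |x i| :=
    Finset.sum_pos' (fun i _ => abs_nonneg _) ⟨i₀, Finset.mem_univ _, abs_pos.2 hi₀⟩
  refine ⟨(∑ i, |x i|)⁻¹ • fun i => |x i|, fun i => ?_, ?_, ?_⟩
  · exact mul_nonneg (inv_nonneg.2 hs.le) (abs_nonneg _)
  · simp only [Pi.smul_apply, smul_eq_mul, ← Finset.mul_sum]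
    exact inv_mul_cancel₀ hs.ne'
  · rw [Matrix.smul_vecMul]
    congr 1
    ext j
    exact (heq j (Finset.mem_univ j)).symm

/-- A property that passes along positive entries of an irreducible matrix holds everywhere as
soon as it holds somewhere. -/
theorem Matrix.IsIrreducible.forall_of_edge {α : Type*} {M : Matrix α α ℝ}
    (hM : M.IsIrreducible) {S : α → Prop} (hS : ∀ i j, 0 < M i j → S i → S j) {i : α} (hi : S i)
    (j : α) : S j := by
  let : Quiver α := M.toQuiver
  obtain ⟨q, -⟩ := hM.connected i j
  induction q with
  | nil => exact hi
  | cons _ e ih => exact hS _ _ e.down ih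

-- Stationarity carries positivity along the edges, starting from a coordinate that cannot vanish.
omit [DecidableEq ι] in
theorem pos_of_stationary (hirr : P.IsIrreducible) {p : ι → ℝ} (hp : ∀ i, 0 ≤ p i)
    (hsum : ∑ i, p i = 1) (hstat : Matrix.vecMul p P = p) (i : ι) : 0 < p i := by
  obtain ⟨i₀, -, hi₀⟩ : ∃ i ∈ Finset.univ, p i ≠ 0 :=
    Finset.exists_ne_zero_of_sum_ne_zero (by rw [hsum]; exact one_ne_zero)
  refine hirr.forall_of_edge (S := fun i => 0 < p i) (fun a b hab ha => ?_)
    (lt_of_le_of_ne (hp i₀) hi₀.symm) i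
  rw [← hstat]
  simp only [Matrix.vecMul, dotProduct]
  exact Finset.sum_pos' (fun l _ => mul_nonneg (hp l) (hirr.nonneg l b))
    ⟨a, Finset.mem_univ _, mul_pos ha hab⟩

/-- The Dirichlet form of a stationary Markov chain. -/
theorem sum_vecMul_sub_mul_div (hP : P ∈ Matrix.rowStochastic ℝ ι) {p : ι → ℝ}
    (hp : ∀ i, 0 < p i) (hstat : Matrix.vecMul p P = p) (w : ι → ℝ) :
    ∑ j, (Matrix.vecMul w P j - w j) * w j / p j =
      -(1 / 2) * ∑ i, ∑ j, p i * P i j * (w i / p i - w j / p j) ^ 2 := by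
  -- Expand the square: the first square uses the row sums, the second uses stationarity, and the
  -- cross term produces `vecMul w P`.
  have h1 : ∑ i, ∑ j, p i * P i j * (w i / p i) ^ 2 = ∑ i, w i ^ 2 / p i := by
    refine Finset.sum_congr rfl fun i _ => ?_
    have := (hp i).ne'
    rw [← Finset.sum_mul, ← Finset.mul_sum, Matrix.sum_row_of_mem_rowStochastic hP]
    field_simp
  have h2 : ∑ i, ∑ j, p i * P i j * (w j / p j) ^ 2 = ∑ i, w i ^ 2 / p i := by
    rw [Finset.sum_comm]
    refine Finset.sum_congr rfl fun j _ => ?_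
    have := (hp j).ne'
    have h := congrFun hstat j
    simp only [Matrix.vecMul, dotProduct] at h
    rw [← Finset.sum_mul, h]
    field_simp
  have h3 : ∑ i, ∑ j, p i * P i j * ((w i / p i) * (w j / p j)) =
      ∑ j, Matrix.vecMul w P j * w j / p j := by
    rw [Finset.sum_comm]
    refine Finset.sum_congr rfl fun j _ => ?_
    simp only [Matrix.vecMul, dotProduct]
    rw [mul_div_assoc, Finset.sum_mul]
    refine Finset.sum_congr rfl fun i _ => ?_
    have := (hp i).ne'
    field_simp
  have h4 : ∑ i, ∑ j, p i * P i j * (w i / p i - w j / p j) ^ 2 =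
      ∑ i, ∑ j, p i * P i j * (w i / p i) ^ 2 + ∑ i, ∑ j, p i * P i j * (w j / p j) ^ 2
        - 2 * ∑ i, ∑ j, p i * P i j * ((w i / p i) * (w j / p j)) := by
    simp only [Finset.mul_sum, ← Finset.sum_add_distrib, ← Finset.sum_sub_distrib]
    refine Finset.sum_congr rfl fun i _ => Finset.sum_congr rfl fun j _ => ?_
    ring
  rw [h4, h1, h2, h3]
  simp only [sub_mul, sub_div, Finset.sum_sub_distrib, ← pow_two]
  ring

/-- If the Dirichlet form vanishes, w/p is constant along edges, hence everywhere; w is then a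
multiple of p, and having sum zero it is zero. -/
theorem sum_vecMul_sub_mul_div_neg (hP : P ∈ Matrix.rowStochastic ℝ ι) (hirr : P.IsIrreducible)
    {p : ι → ℝ} (hp : ∀ i, 0 < p i) (hstat : Matrix.vecMul p P = p)
    {w : ι → ℝ} (hw : ∑ i, w i = 0) (hw0 : w ≠ 0) :
    ∑ j, (Matrix.vecMul w P j - w j) * w j / p j < 0 := by
  rw [sum_vecMul_sub_mul_div hP hp hstat]
  have hnn : ∀ i j, 0 ≤ p i * P i j * (w i / p i - w j / p j) ^ 2 := fun i j =>
    mul_nonneg (mul_nonneg (hp i).le (hirr.nonneg i j)) (sq_nonneg _)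
  suffices 0 < ∑ i, ∑ j, p i * P i j * (w i / p i - w j / p j) ^ 2 by linarith
  refine lt_of_le_of_ne (Finset.sum_nonneg fun i _ => Finset.sum_nonneg fun j _ => hnn i j) ?_
  intro h0
  have hz : ∀ i j, p i * P i j * (w i / p i - w j / p j) ^ 2 = 0 := by
    intro i j
    have h1 := (Finset.sum_eq_zero_iff_of_nonneg
      (fun i _ => Finset.sum_nonneg fun j _ => hnn i j)).1 h0.symm i (Finset.mem_univ _)
    exact (Finset.sum_eq_zero_iff_of_nonneg (fun j _ => hnn i j)).1 h1 j (Finset.mem_univ _)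
  obtain ⟨i₀, hi₀⟩ := Function.ne_iff.1 hw0
  have hconst : ∀ j, w j / p j = w i₀ / p i₀ :=
    hirr.forall_of_edge (S := fun j => w j / p j = w i₀ / p i₀) (i := i₀)
      (fun i j hij hi => by
        have h := hz i j
        have h2 : w i / p i - w j / p j = 0 := by
          simpa [(hp i).ne', hij.ne'] using h
        linarith) rfl
  have hwj : ∀ j, w j = w i₀ / p i₀ * p j := fun j => by
    rw [← hconst j, div_mul_cancel₀ _ (hp j).ne']
  have hsum : w i₀ / p i₀ * ∑ j, p j = 0 := by
    rw [Finset.mul_sum, ← hw]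
    exact Finset.sum_congr rfl fun j _ => (hwj j).symm
  have hps : 0 < ∑ j, p j := Finset.sum_pos (fun j _ => hp j) ⟨i₀, Finset.mem_univ _⟩
  rcases mul_eq_zero.1 hsum with h | h
  · exact hi₀ (by rw [hwj i₀, h, zero_mul]; rfl)
  · exact hps.ne' h

/-- The spectral gap of an irreducible chain, in the norm weighted by the stationary law. -/
theorem exists_spectral_gap (hP : P ∈ Matrix.rowStochastic ℝ ι) (hirr : P.IsIrreducible)
    {p : ι → ℝ} (hp : ∀ i, 0 < p i) (hstat : Matrix.vecMul p P = p) :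
    ∃ c : ℝ, 0 < c ∧ c ≤ 1 ∧ ∀ w : ι → ℝ, ∑ i, w i = 0 →
      ∑ j, (Matrix.vecMul w P j - w j) * w j / p j ≤ -c * ∑ j, w j ^ 2 / p j := by
  let F : (ι → ℝ) → ℝ := fun w => ∑ j, (Matrix.vecMul w P j - w j) * w j / p j
  -- The unit sphere of the weighted norm in the sum-zero hyperplane is compact, so the negative
  -- form attains its maximum there; homogeneity gives the rest.
  let K : Set (ι → ℝ) := {w | ∑ i, w i = 0 ∧ ∑ j, w j ^ 2 / p j = 1}
  have hF : Continuous F := by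
    simp only [F, Matrix.vecMul, dotProduct]
    fun_prop
  have hKc : IsClosed K := by
    refine IsClosed.inter (isClosed_eq (by fun_prop) continuous_const)
      (isClosed_eq (by fun_prop) continuous_const)
  have hK : IsCompact K := by
    refine IsCompact.of_isClosed_subset
      (isCompact_univ_pi fun i => isCompact_Icc (a := -(p i + 1)) (b := p i + 1)) hKc ?_
    rintro w ⟨-, hw⟩ i -
    have h1 : w i ^ 2 / p i ≤ 1 := by
      rw [← hw]
      exact Finset.single_le_sum (f := fun j => w j ^ 2 / p j)
        (fun j _ => div_nonneg (sq_nonneg _) (hp j).le) (Finset.mem_univ i)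
    rw [div_le_one (hp i)] at h1
    have := hp i
    exact abs_le.1 (abs_le_of_sq_le_sq (by nlinarith) (by linarith))
  obtain ⟨c, hc0, hc1, hc⟩ : ∃ c : ℝ, 0 < c ∧ c ≤ 1 ∧ ∀ w ∈ K, F w ≤ -c := by
    rcases K.eq_empty_or_nonempty with h | h
    -- With a single state the sphere is empty and any constant serves.
    · exact ⟨1, one_pos, le_rfl, by simp [h]⟩
    · obtain ⟨v, hv, hmax⟩ := hK.exists_isMaxOn h hF.continuousOn
      have hv0 : v ≠ 0 := by
        rintro rfl
        simpa using hv.2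
      have hneg : F v < 0 := sum_vecMul_sub_mul_div_neg hP hirr hp hstat hv.1 hv0
      -- The cap at 1 keeps the later contraction factors 1 - c/(n+2) nonnegative.
      refine ⟨min (-F v) 1, lt_min (by linarith) one_pos, min_le_right _ _, fun w hw => ?_⟩
      have h1 : F w ≤ F v := hmax hw
      have h2 := min_le_left (-F v) 1
      linarith
  refine ⟨c, hc0, hc1, fun w hw => ?_⟩
  set Q := ∑ j, w j ^ 2 / p j with hQ
  have hQ0 : 0 ≤ Q := Finset.sum_nonneg fun j _ => div_nonneg (sq_nonneg _) (hp j).le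
  rcases hQ0.eq_or_lt with h0 | h0
  · have hz : ∀ j, w j = 0 := by
      intro j
      have h := (Finset.sum_eq_zero_iff_of_nonneg
        fun j _ => div_nonneg (sq_nonneg (w j)) (hp j).le).1 (hQ.symm.trans h0.symm) j
        (Finset.mem_univ j)
      simpa [(hp j).ne'] using h
    rw [← h0]
    simp [hz]
  · set s := (√Q)⁻¹ with hs
    have hs2 : s ^ 2 * Q = 1 := by
      rw [hs, inv_pow, Real.sq_sqrt hQ0, inv_mul_cancel₀ h0.ne']
    have hmem : s • w ∈ K := by
      constructor
      · simp [← Finset.mul_sum, hw]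
      · rw [← hs2, hQ, Finset.mul_sum]
        refine Finset.sum_congr rfl fun j _ => ?_
        simp only [Pi.smul_apply, smul_eq_mul]
        ring
    have h1 := hc _ hmem
    have h2 : F (s • w) = s ^ 2 * F w := by
      simp only [F, Finset.mul_sum]
      refine Finset.sum_congr rfl fun j _ => ?_
      rw [Matrix.smul_vecMul]
      simp only [Pi.smul_apply, smul_eq_mul]
      ring
    rw [h2] at h1
    have h3 := mul_le_mul_of_nonneg_left h1 hQ0
    have h4 : Q * (s ^ 2 * F w) = F w := by
      rw [← mul_assoc, mul_comm Q, hs2, one_mul]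
    rw [h4] at h3
    linarith

/-- The difference x - p has sum zero and zero drift, which strict negativity forbids unless it
vanishes. -/
theorem eq_of_stationary (hP : P ∈ Matrix.rowStochastic ℝ ι) (hirr : P.IsIrreducible)
    {p : ι → ℝ} (hp : ∀ i, 0 < p i) (hstat : Matrix.vecMul p P = p)
    {x : ι → ℝ} (hx : Matrix.vecMul x P = x) (hsum : ∑ i, x i = ∑ i, p i) : x = p := by
  by_contra hne
  have h := sum_vecMul_sub_mul_div_neg hP hirr hp hstat (w := x - p) (by simp [hsum])
    (sub_ne_zero.2 hne)
  rw [Matrix.sub_vecMul, hx, hstat] at h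
  simp at h

end Stationary

/-! ### Deterministic recursions with harmonic step sizes. -/

section Recursion

/-- Once δ < cε, the excess of q over ε contracts by 1 - c/(n+2) ≤ exp(-c/(n+2)), and the harmonic
series diverges. -/
theorem tendsto_zero_of_recursion_le {q δ : ℕ → ℝ} {c : ℝ} (hc : 0 < c) (hc1 : c ≤ 1)
    (hq : ∀ n, 0 ≤ q n) (hδ : Tendsto δ atTop (𝓝 0))
    (hrec : ∀ n : ℕ, q (n + 1) ≤ (1 - c / (n + 2)) * q n + δ n / (n + 2)) :
    Tendsto q atTop (𝓝 0) := by
  have key : ∀ ε > 0, Tendsto (fun n => max (q n - ε) 0) atTop (𝓝 0) := by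
    intro ε hε
    -- The range n+1 makes the increment of s from n to n+1 equal to 1/(n+2).
    let s : ℕ → ℝ := fun n => ∑ i ∈ Finset.range (n + 1), (1 : ℝ) / ((i : ℝ) + 1)
    have hs : Tendsto s atTop atTop :=
      Real.tendsto_sum_range_one_div_nat_succ_atTop.comp (tendsto_add_atTop_nat 1)
    obtain ⟨N, hN⟩ := eventually_atTop.1 (hδ.eventually (gt_mem_nhds (mul_pos hc hε)))
    have hstep : ∀ n ≥ N, max (q (n + 1) - ε) 0 * Real.exp (c * s (n + 1)) ≤
        max (q n - ε) 0 * Real.exp (c * s n) := by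
      intro n hn
      have ha : (0 : ℝ) < n + 2 := by positivity
      have hca : c / (n + 2) ≤ 1 := by
        rw [div_le_one ha]
        have : (0 : ℝ) ≤ n := n.cast_nonneg
        linarith
      have h1 : q (n + 1) - ε ≤ (1 - c / (n + 2)) * (q n - ε) := by
        have h2 : δ n / (n + 2) ≤ c / (n + 2) * ε := by
          rw [div_mul_eq_mul_div]
          exact div_le_div_of_nonneg_right (hN n hn).le ha.le
        linarith [hrec n]
      have h3 : max (q (n + 1) - ε) 0 ≤ (1 - c / (n + 2)) * max (q n - ε) 0 := by
        refine max_le (h1.trans ?_) ?_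
        · exact mul_le_mul_of_nonneg_left (le_max_left _ _) (by linarith)
        · exact mul_nonneg (by linarith) (le_max_right _ _)
      have h4 : 1 - c / (n + 2) ≤ Real.exp (-(c / (n + 2))) := by
        linarith [Real.add_one_le_exp (-(c / ((n : ℝ) + 2)))]
      have h5 : s (n + 1) = s n + 1 / ((n : ℝ) + 2) := by
        simp only [s]
        rw [Finset.sum_range_succ _ (n + 1)]
        push_cast
        ring
      calc max (q (n + 1) - ε) 0 * Real.exp (c * s (n + 1))
          ≤ (Real.exp (-(c / (n + 2))) * max (q n - ε) 0) * Real.exp (c * s (n + 1)) := by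
            refine mul_le_mul_of_nonneg_right (h3.trans ?_) (Real.exp_pos _).le
            exact mul_le_mul_of_nonneg_right h4 (le_max_right _ _)
        _ = max (q n - ε) 0 * (Real.exp (-(c / (n + 2))) * Real.exp (c * s (n + 1))) := by ring
        _ = max (q n - ε) 0 * Real.exp (c * s n) := by
            rw [← Real.exp_add, h5]
            congr 2
            ring
    have hbd : ∀ n ≥ N, max (q n - ε) 0 * Real.exp (c * s n) ≤
        max (q N - ε) 0 * Real.exp (c * s N) := by
      intro n hn
      induction n, hn using Nat.le_induction with
      | base => exact le_rfl
      | succ n hn ih => exact (hstep n hn).trans ih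
    have hlim : Tendsto (fun n => max (q N - ε) 0 * Real.exp (c * s N) * Real.exp (-(c * s n)))
        atTop (𝓝 0) := by
      have : Tendsto (fun n => Real.exp (-(c * s n))) atTop (𝓝 0) :=
        Real.tendsto_exp_neg_atTop_nhds_zero.comp (hs.const_mul_atTop hc)
      simpa using this.const_mul (max (q N - ε) 0 * Real.exp (c * s N))
    refine squeeze_zero' (Eventually.of_forall fun n => le_max_right _ _) ?_ hlim
    filter_upwards [eventually_ge_atTop N] with n hn
    rw [Real.exp_neg, ← div_eq_mul_inv, le_div_iff₀ (Real.exp_pos _)]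
    exact hbd n hn
  rw [Metric.tendsto_atTop]
  intro ε hε
  obtain ⟨N, hN⟩ := Metric.tendsto_atTop.1 (key (ε / 2) (half_pos hε)) (ε / 2) (half_pos hε)
  refine ⟨N, fun n hn => ?_⟩
  have h := hN n hn
  rw [Real.dist_eq, sub_zero] at h ⊢
  rw [abs_of_nonneg (hq n)]
  have h1 := le_max_left (q n - ε / 2) 0
  have h2 := le_abs_self (max (q n - ε / 2) 0)
  linarith

variable {ι : Type*} [Fintype ι] [DecidableEq ι] {P : Matrix ι ι ℝ}

/-- A bounded sequence of signed unit masses that, up to a vanishing perturbation, moves along the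
flow of an irreducible Markov chain with step sizes `1 / (n + 2)` converges to the stationary
law. -/
theorem tendsto_stationary_of_recursion (hP : P ∈ Matrix.rowStochastic ℝ ι)
    (hirr : P.IsIrreducible) {p : ι → ℝ} (hp : ∀ i, 0 < p i) (hpsum : ∑ i, p i = 1)
    (hstat : Matrix.vecMul p P = p) {x b : ℕ → ι → ℝ} {C : ℝ} (hxC : ∀ n i, |x n i| ≤ C)
    (hx : ∀ n, ∑ i, x n i = 1) (hxb : ∀ i, Tendsto (fun n => x n i - b n i) atTop (𝓝 0))
    (hb : ∀ (n : ℕ) i, b (n + 1) i = b n i + (Matrix.vecMul (x n) P i - x n i) / (n + 2))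
    (i : ι) : Tendsto (fun n => x n i) atTop (𝓝 (p i)) := by
  obtain ⟨c, hc0, hc1, hc⟩ := exists_spectral_gap hP hirr hp hstat
  -- The recursion conserves the mass of b, and x - b → 0 identifies it as 1. The gap applies only
  -- to sum-zero vectors, so b - p must be exactly of this kind.
  have hbsum : ∀ n, ∑ i, b n i = 1 := by
    have hconst : ∀ n, ∑ i, b n i = ∑ i, b 0 i := by
      intro n
      induction n with
      | zero => rfl
      | succ n ih =>
        simp only [hb, Finset.sum_add_distrib, ← Finset.sum_div, Finset.sum_sub_distrib,
          sum_vecMul_of_mem_rowStochastic hP, sub_self, zero_div, add_zero, ih]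
    have hlim : Tendsto (fun n => ∑ i, (x n i - b n i)) atTop (𝓝 0) := by
      simpa using tendsto_finsetSum Finset.univ fun i _ => hxb i
    simp only [Finset.sum_sub_distrib, hx, hconst] at hlim
    have := tendsto_nhds_unique hlim tendsto_const_nhds
    intro n
    rw [hconst]
    linarith
  let G : (ι → ℝ) → ι → ℝ := fun v => Matrix.vecMul v P - v
  have hG : ∀ u v, G (u + v) = G u + G v := fun u v => by
    simp only [G, Matrix.add_vecMul]
    abel
  let w : ℕ → ι → ℝ := fun n => b n - p
  let e : ℕ → ι → ℝ := fun n => x n - b n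
  have hGx : ∀ n, G (x n) = G (w n) + G (e n) := fun n => by
    have h0 : G p = 0 := by simp only [G, hstat, sub_self]
    have h1 : x n = w n + e n + p := by simp only [w, e]; abel
    rw [h1, hG, hG, h0, add_zero]
  have hwsum : ∀ n, ∑ i, w n i = 0 := fun n => by simp [w, hbsum, hpsum]
  let q : ℕ → ℝ := fun n => ∑ j, w n j ^ 2 / p j
  -- Everything in the expansion of q (n+1) beyond the drift of w: the cross term from x - b and the
  -- second-order term.
  let δ : ℕ → ℝ := fun n => 2 * ∑ j, G (e n) j * w n j / p j +
    1 / ((n : ℝ) + 2) * ∑ j, G (x n) j ^ 2 / p j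
  have hq0 : ∀ n, 0 ≤ q n := fun n =>
    Finset.sum_nonneg fun j _ => div_nonneg (sq_nonneg _) (hp j).le
  have hxO : ∀ j, (fun n => x n j) =O[atTop] (fun _ => (1 : ℝ)) := fun j =>
    Asymptotics.IsBigO.of_bound C (Eventually.of_forall fun n => by simpa using hxC n j)
  have heo : ∀ j, (fun n => e n j) =o[atTop] (fun _ => (1 : ℝ)) := fun j =>
    (Asymptotics.isLittleO_one_iff ℝ).2 (hxb j)
  have hwO : ∀ j, (fun n => w n j) =O[atTop] (fun _ => (1 : ℝ)) := fun j => by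
    have h := ((hxO j).sub (heo j).isBigO).sub
      (Asymptotics.isBigO_const_const (p j) (one_ne_zero (α := ℝ)) atTop)
    refine h.congr_left fun n => ?_
    simp [w, e]
  have hGeo : ∀ j, (fun n => G (e n) j) =o[atTop] (fun _ => (1 : ℝ)) := fun j => by
    simp only [G, Matrix.vecMul, dotProduct, Pi.sub_apply]
    refine Asymptotics.IsLittleO.sub (Asymptotics.IsLittleO.fun_sum fun i _ => ?_) (heo j)
    simpa [mul_comm] using (heo i).const_mul_left (P i j)
  have hGxO : ∀ j, (fun n => G (x n) j) =O[atTop] (fun _ => (1 : ℝ)) := fun j => by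
    simp only [G, Matrix.vecMul, dotProduct, Pi.sub_apply]
    refine Asymptotics.IsBigO.sub (Asymptotics.IsBigO.fun_sum fun i _ => ?_) (hxO j)
    simpa [mul_comm] using (hxO i).const_mul_left (P i j)
  have hδ : Tendsto δ atTop (𝓝 0) := by
    rw [← Asymptotics.isLittleO_one_iff ℝ]
    refine Asymptotics.IsLittleO.add (Asymptotics.IsLittleO.const_mul_left
      (Asymptotics.IsLittleO.fun_sum fun j _ => ?_) _) ?_
    · have h := ((hGeo j).mul_isBigO (hwO j)).const_mul_left (p j)⁻¹
      simp only [mul_one] at h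
      exact h.congr_left fun n => by rw [div_eq_inv_mul]
    · have h1 : (fun n : ℕ => 1 / ((n : ℝ) + 2)) =o[atTop] (fun _ => (1 : ℝ)) := by
        rw [Asymptotics.isLittleO_one_iff ℝ]
        simp only [one_div]
        exact tendsto_inv_atTop_zero.comp
          (tendsto_atTop_add_const_right _ _ tendsto_natCast_atTop_atTop)
      have h2 : (fun n => ∑ j, G (x n) j ^ 2 / p j) =O[atTop] (fun _ => (1 : ℝ)) := by
        refine Asymptotics.IsBigO.fun_sum fun j _ => ?_
        have h := ((hGxO j).pow 2).const_mul_left (p j)⁻¹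
        simp only [one_pow] at h
        exact h.congr_left fun n => by rw [div_eq_inv_mul]
      simpa using h1.mul_isBigO h2
  have hrec : ∀ n : ℕ, q (n + 1) ≤ (1 - c / (n + 2)) * q n + δ n / (n + 2) := by
    intro n
    have ha : (0 : ℝ) < n + 2 := by positivity
    have h1 : q (n + 1) = q n + 2 * (1 / (n + 2)) * (∑ j, G (w n) j * w n j / p j +
        ∑ j, G (e n) j * w n j / p j) + (1 / (n + 2)) ^ 2 * ∑ j, G (x n) j ^ 2 / p j := by
      simp only [q, ← Finset.sum_add_distrib, Finset.mul_sum]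
      refine Finset.sum_congr rfl fun j _ => ?_
      have h2 : w (n + 1) j = w n j + 1 / (n + 2) * G (x n) j := by
        simp only [w, G, Pi.sub_apply, hb]
        ring
      have h3 : G (x n) j = G (w n) j + G (e n) j := congrFun (hGx n) j
      rw [h2]
      have h4 : G (w n) j = G (x n) j - G (e n) j := by linarith
      rw [h4]
      ring
    have h2 : ∑ j, G (w n) j * w n j / p j ≤ -c * q n := hc (w n) (hwsum n)
    have h3 : 2 * (1 / ((n : ℝ) + 2)) * ∑ j, G (w n) j * w n j / p j ≤
        2 * (1 / ((n : ℝ) + 2)) * (-c * q n) :=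
      mul_le_mul_of_nonneg_left h2 (by positivity)
    -- The expansion yields the factor 1 - 2c/(n+2); one of the two copies of c is given up.
    have h4 : 0 ≤ 1 / ((n : ℝ) + 2) * (c * q n) := by
      have := hq0 n
      positivity
    have h5 : (1 - c / (n + 2)) * q n + δ n / (n + 2) = q n - 1 / ((n : ℝ) + 2) * (c * q n) +
        (2 * (1 / (n + 2)) * ∑ j, G (e n) j * w n j / p j +
          (1 / (n + 2)) ^ 2 * ∑ j, G (x n) j ^ 2 / p j) := by
      simp only [δ]
      ring
    rw [h1, h5]
    linarith
  have hq : Tendsto q atTop (𝓝 0) := tendsto_zero_of_recursion_le hc0 hc1 hq0 hδ hrec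
  have hw2 : Tendsto (fun n => w n i ^ 2) atTop (𝓝 0) := by
    refine squeeze_zero (fun n => sq_nonneg _) (fun n => ?_) (by simpa using hq.const_mul (p i))
    rw [← div_le_iff₀' (hp i)]
    exact Finset.single_le_sum (f := fun j => w n j ^ 2 / p j)
      (fun j _ => div_nonneg (sq_nonneg _) (hp j).le) (Finset.mem_univ i)
  have hw : Tendsto (fun n => w n i) atTop (𝓝 0) := by
    rw [tendsto_zero_iff_abs_tendsto_zero]
    have h := hw2.sqrt
    simp only [Real.sqrt_sq_eq_abs, Real.sqrt_zero] at h
    exact h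
  have h := (hw.add (hxb i)).add_const (p i)
  simp only [zero_add] at h
  refine h.congr fun n => ?_
  simp only [w, Pi.sub_apply]
  ring

end Recursion

/-! ### Almost sure convergence of the noise series. -/

/-- A series of bounded martingale differences with square-summable weights converges almost
surely. -/
theorem ae_exists_tendsto_sum_of_martingale_diff {Ω : Type*} [m0 : MeasurableSpace Ω]
    {P : Measure Ω} [IsProbabilityMeasure P] {ℱ : Filtration ℕ m0} {D : ℕ → Ω → ℝ} {C : ℝ}
    (hD : ∀ n, StronglyMeasurable[ℱ (n + 1)] (D n)) (hbd : ∀ n, ∀ᵐ ω ∂P, |D n ω| ≤ C)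
    (hmean : ∀ n, P[D n | ℱ n] =ᵐ[P] 0) {a : ℕ → ℝ} (ha : Summable fun n => a n ^ 2) :
    ∀ᵐ ω ∂P, ∃ l, Tendsto (fun n => ∑ m ∈ Finset.range n, a m * D m ω) atTop (𝓝 l) := by
  let Y : ℕ → Ω → ℝ := fun n ω => ∑ m ∈ Finset.range n, a m * D m ω
  have hYs : ∀ n ω, Y (n + 1) ω = Y n ω + a n * D n ω := fun n ω =>
    Finset.sum_range_succ _ _
  have hYmeas : ∀ n, StronglyMeasurable[ℱ n] (Y n) := by
    intro n
    refine Finset.stronglyMeasurable_fun_sum _ fun m hm => ?_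
    exact ((hD m).mono (ℱ.mono (Finset.mem_range.1 hm))).const_mul _
  have hDL : ∀ n, MemLp (D n) 2 P := fun n =>
    MemLp.of_bound ((hD n).mono (ℱ.le _)).aestronglyMeasurable C (hbd n)
  have hYL : ∀ n, MemLp (Y n) 2 P := fun n => by
    have := memLp_finsetSum (Finset.range n) (f := fun m ω => a m * D m ω) (p := 2) (μ := P)
      fun m _ => (hDL m).const_mul (a m)
    exact this
  have hmart : Martingale Y ℱ P := by
    refine martingale_of_condExp_sub_eq_zero_nat hYmeas
      (fun n => (hYL n).integrable one_le_two) fun n => ?_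
    have h1 : Y (n + 1) - Y n = a n • D n := by
      ext ω
      simp [hYs]
    rw [h1]
    filter_upwards [condExp_smul (μ := P) (a n) (D n) (ℱ n), hmean n] with ω h2 h3
    rw [h2, Pi.smul_apply, h3]
    simp
  have horth : ∀ n, ∫ ω, Y n ω * D n ω ∂P = 0 := by
    intro n
    have hint : Integrable (Y n * D n) P := (hYL n).integrable_mul (hDL n)
    have h1 := condExp_mul_of_stronglyMeasurable_left (hYmeas n) hint
      ((hDL n).integrable one_le_two)
    have h2 : P[Y n * D n | ℱ n] =ᵐ[P] 0 := by
      filter_upwards [h1, hmean n] with ω h3 h4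
      rw [h3, Pi.mul_apply, h4]
      simp
    have h3 := integral_condExp (μ := P) (ℱ.le n) (f := Y n * D n)
    rw [integral_congr_ae h2] at h3
    simpa using h3.symm
  -- Orthogonality of the increments makes second moments additive; then |y| ≤ 1 + y² gives the L¹
  -- bound for Doob's convergence theorem.
  have hsq : ∀ n, ∫ ω, Y n ω ^ 2 ∂P ≤ C ^ 2 * ∑ m ∈ Finset.range n, a m ^ 2 := by
    intro n
    induction n with
    | zero => simp [Y]
    | succ n ih =>
      have h1 : ∀ ω, Y (n + 1) ω ^ 2 =
          Y n ω ^ 2 + 2 * a n * (Y n ω * D n ω) + a n ^ 2 * D n ω ^ 2 := fun ω => by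
        rw [hYs]
        ring
      have i1 : Integrable (fun ω => Y n ω ^ 2) P := (hYL n).integrable_sq
      have i2 : Integrable (fun ω => 2 * a n * (Y n ω * D n ω)) P :=
        ((hYL n).integrable_mul (hDL n)).const_mul _
      have i3 : Integrable (fun ω => a n ^ 2 * D n ω ^ 2) P := (hDL n).integrable_sq.const_mul _
      have h2 : ∫ ω, D n ω ^ 2 ∂P ≤ C ^ 2 := by
        have h := integral_mono_ae (hDL n).integrable_sq (integrable_const (C ^ 2)) (by
          filter_upwards [hbd n] with ω hω
          exact sq_le_sq' (abs_le.1 hω).1 (abs_le.1 hω).2)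
        simpa using h
      simp only [h1]
      have i12 : Integrable (fun ω => Y n ω ^ 2 + 2 * a n * (Y n ω * D n ω)) P := i1.add i2
      rw [integral_add i12 i3, integral_add i1 i2, integral_const_mul, integral_const_mul,
        horth, Finset.sum_range_succ]
      have h3 := mul_le_mul_of_nonneg_left h2 (sq_nonneg (a n))
      linarith
  set B : ℝ := 1 + C ^ 2 * ∑' m, a m ^ 2 with hB
  have hL1 : ∀ n, eLpNorm (Y n) 1 P ≤ (B.toNNReal : ENNReal) := by
    intro n
    rw [eLpNorm_one_eq_lintegral_enorm,
      ← ofReal_integral_norm_eq_lintegral_enorm ((hYL n).integrable one_le_two)]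
    refine ENNReal.ofReal_le_ofReal ?_
    have h1 : ∫ ω, ‖Y n ω‖ ∂P ≤ ∫ ω, (1 + Y n ω ^ 2) ∂P := by
      refine integral_mono ((hYL n).integrable one_le_two).norm
        ((integrable_const 1).add (hYL n).integrable_sq) fun ω => ?_
      simp only [Real.norm_eq_abs]
      rw [← sq_abs (Y n ω)]
      nlinarith [sq_nonneg (|Y n ω| - 1), abs_nonneg (Y n ω)]
    rw [integral_add (integrable_const 1) (hYL n).integrable_sq] at h1
    have h2 : ∑ m ∈ Finset.range n, a m ^ 2 ≤ ∑' m, a m ^ 2 :=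
      ha.sum_le_tsum _ fun m _ => sq_nonneg _
    have h3 := mul_le_mul_of_nonneg_left h2 (sq_nonneg C)
    have h4 := hsq n
    simp only [integral_const, probReal_univ, smul_eq_mul, mul_one] at h1
    linarith
  exact hmart.submartingale.exists_ae_tendsto_of_bdd hL1

/-! ### The urn as a noisy flow of `urnRhat`. -/

section Urn

variable {k : ℕ} {θ : ℝ} {R : Matrix (Fin k) (Fin k) ℝ}

theorem urnRhat_mem_rowStochastic (hkθ : 1 < (k : ℝ) * θ)
    (hR : R ∈ Matrix.rowStochastic ℝ (Fin k)) (hirr : (urnRhat R θ).IsIrreducible) :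
    urnRhat R θ ∈ Matrix.rowStochastic ℝ (Fin k) := by
  refine Matrix.mem_rowStochastic_iff_sum.2 ⟨hirr.nonneg, fun i => ?_⟩
  have : (k : ℝ) * θ - 1 ≠ 0 := by linarith
  simp [urnRhat_apply θ hR, ← Finset.sum_div, Matrix.sum_row_of_mem_rowStochastic hR, this]

theorem vecMul_urnRhat (hR : R ∈ Matrix.rowStochastic ℝ (Fin k)) (x : Fin k → ℝ) (j : Fin k) :
    Matrix.vecMul x (urnRhat R θ) j =
      (θ * ∑ i, x i - Matrix.vecMul x R j) / ((k : ℝ) * θ - 1) := by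
  simp only [Matrix.vecMul, dotProduct, urnRhat_apply θ hR, Finset.mul_sum,
    ← Finset.sum_sub_distrib, Finset.sum_div]
  refine Finset.sum_congr rfl fun i _ => ?_
  ring

theorem urn_equation_of_stationary (hkθ : 1 < (k : ℝ) * θ)
    (hR : R ∈ Matrix.rowStochastic ℝ (Fin k)) {p : Fin k → ℝ} (hsum : ∑ i, p i = 1)
    (hstat : Matrix.vecMul p (urnRhat R θ) = p) {μ : Fin k → ℝ}
    (hμ : ∀ j, μ j = θ - ((k : ℝ) * θ - 1) * p j) :
    Matrix.vecMul (θ • (1 : Fin k → ℝ) - μ) R = ((k : ℝ) * θ - 1) • μ := by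
  have hκ : (k : ℝ) * θ - 1 ≠ 0 := by linarith
  have h1 : θ • (1 : Fin k → ℝ) - μ = ((k : ℝ) * θ - 1) • p := by
    ext j
    simp [hμ]
  rw [h1, Matrix.smul_vecMul]
  congr 1
  ext j
  have h2 := congrFun hstat j
  rw [vecMul_urnRhat hR, hsum, div_eq_iff hκ] at h2
  rw [hμ]
  linarith

theorem stationary_of_urn_equation (hkθ : 1 < (k : ℝ) * θ)
    (hR : R ∈ Matrix.rowStochastic ℝ (Fin k)) {μ : Fin k → ℝ}
    (hμ : Matrix.vecMul (θ • (1 : Fin k → ℝ) - μ) R = ((k : ℝ) * θ - 1) • μ)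
    {x : Fin k → ℝ} (hx : ∀ j, x j = (θ - μ j) / ((k : ℝ) * θ - 1)) :
    ∑ i, x i = 1 ∧ Matrix.vecMul x (urnRhat R θ) = x := by
  have hκ : (k : ℝ) * θ - 1 ≠ 0 := by linarith
  -- Summing the equation over colours gives kθ - Σμ = (kθ - 1)Σμ.
  have hμsum : ∑ j, μ j = 1 := by
    have h := sum_vecMul_of_mem_rowStochastic hR (θ • (1 : Fin k → ℝ) - μ)
    simp only [hμ, Pi.smul_apply, Pi.sub_apply, Pi.one_apply, smul_eq_mul, mul_one,
      ← Finset.mul_sum, Finset.sum_sub_distrib, Finset.sum_const, Finset.card_univ,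
      Fintype.card_fin, nsmul_eq_mul] at h
    have h0 : (k : ℝ) * θ ≠ 0 := by linarith
    exact mul_left_cancel₀ h0 (by linarith)
  have hsum : ∑ i, x i = 1 := by
    simp [hx, ← Finset.sum_div, hμsum, hκ]
  have hxR : Matrix.vecMul x R = μ := by
    have h1 : θ • (1 : Fin k → ℝ) - μ = ((k : ℝ) * θ - 1) • x := by
      ext j
      simp [hx, mul_div_cancel₀ _ hκ]
    rw [h1, Matrix.smul_vecMul] at hμ
    exact smul_right_injective _ hκ hμ
  refine ⟨hsum, ?_⟩
  ext j
  rw [vecMul_urnRhat hR, hsum, hxR, hx, mul_one]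

/-- The conditional probabilities of the `(n + 1)`-th draw. -/
noncomputable def urnDrawProb {Ω : Type*} (θ : ℝ) (U : ℕ → Ω → Fin k → ℝ) (n : ℕ) (ω : Ω)
    (j : Fin k) : ℝ :=
  urnWeight θ (U n ω j / (n + 1)) / ∑ i, urnWeight θ (U n ω i / (n + 1))

/-- Conservation of mass makes the denominator constant, which is what linearises the dynamics. -/
theorem urnDrawProb_eq {Ω : Type*} {U : ℕ → Ω → Fin k → ℝ} {n : ℕ} {ω : Ω}
    (hsum : ∑ j, U n ω j = n + 1) (j : Fin k) :
    urnDrawProb θ U n ω j = (θ - U n ω j / (n + 1)) / ((k : ℝ) * θ - 1) := by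
  have hn : (n : ℝ) + 1 ≠ 0 := by positivity
  simp [urnDrawProb, urnWeight, Finset.sum_sub_distrib, ← Finset.sum_div, hsum, hn]

theorem urnDrawProb_mem_stdSimplex {Ω : Type*} {U : ℕ → Ω → Fin k → ℝ} {n : ℕ} {ω : Ω}
    (hθ : 1 ≤ θ) (hkθ : 1 < (k : ℝ) * θ) (hU : ∀ j, 0 ≤ U n ω j)
    (hsum : ∑ j, U n ω j = n + 1) : urnDrawProb θ U n ω ∈ stdSimplex ℝ (Fin k) := by
  have hn : (0 : ℝ) < n + 1 := by positivity
  have hκ : 0 < (k : ℝ) * θ - 1 := by linarith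
  constructor
  · intro j
    rw [urnDrawProb_eq hsum]
    refine div_nonneg ?_ hκ.le
    have h1 : U n ω j / (n + 1) ≤ 1 := by
      rw [div_le_one hn, ← hsum]
      exact Finset.single_le_sum (fun j _ => hU j) (Finset.mem_univ j)
    linarith
  · simp only [urnDrawProb_eq hsum, ← Finset.sum_div, Finset.sum_sub_distrib, hsum]
    simp [hκ.ne', hn.ne']

/-- The natural filtration of the urn. -/
def urnFiltration {Ω : Type*} [m0 : MeasurableSpace Ω] {U : ℕ → Ω → Fin k → ℝ}
    (hU : ∀ n, Measurable (U n)) : Filtration ℕ m0 where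
  seq := urnHistory U
  mono' _ _ hmn := biSup_mono fun _ hi => hi.trans hmn
  le' _ := iSup₂_le fun m _ => (hU m).comap_le

theorem measurable_urnHistory {Ω : Type*} (U : ℕ → Ω → Fin k → ℝ) {m n : ℕ} (hmn : m ≤ n) :
    Measurable[urnHistory U n] (U m) :=
  (comap_measurable (U m)).mono (le_iSup₂_of_le m hmn le_rfl) le_rfl

theorem measurable_urnDrawProb {Ω : Type*} (U : ℕ → Ω → Fin k → ℝ) (n : ℕ) :
    Measurable[urnHistory U n] (urnDrawProb θ U n) := by
  have h := measurable_urnHistory U (le_refl n)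
  let _ : MeasurableSpace Ω := urnHistory U n
  have h1 : ∀ j, Measurable fun ω => U n ω j := fun j => (measurable_pi_apply j).comp h
  refine measurable_pi_lambda _ fun j => ?_
  unfold urnDrawProb urnWeight
  fun_prop

namespace IsNegReinforcedUrn

variable {Ω : Type*} [MeasurableSpace Ω] {P : Measure Ω} {U : ℕ → Ω → Fin k → ℝ}
  {Z : ℕ → Ω → Fin k}

theorem step_apply (h : IsNegReinforcedUrn P R θ U Z) (n : ℕ) :
    ∀ᵐ ω ∂P, ∀ j, U (n + 1) ω j = U n ω j + R (Z n ω) j := by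
  filter_upwards [h.step n] with ω hω j
  rw [hω]
  simp [Matrix.vecMul, dotProduct]

theorem ae_config (h : IsNegReinforcedUrn P R θ U Z)
    (hR : R ∈ Matrix.rowStochastic ℝ (Fin k)) :
    ∀ᵐ ω ∂P, ∀ n : ℕ, (∀ j, 0 ≤ U n ω j) ∧ ∑ j, U n ω j = n + 1 := by
  filter_upwards [h.initial, ae_all_iff.2 h.step_apply] with ω h0 hs n
  induction n with
  | zero => exact ⟨h0.1, by simpa using h0.2⟩
  | succ n ih =>
    refine ⟨fun j => ?_, ?_⟩
    · rw [hs]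
      exact add_nonneg (ih.1 j) (hR.1 _ j)
    · simp only [hs, Finset.sum_add_distrib, ih.2, Matrix.sum_row_of_mem_rowStochastic hR]
      push_cast
      ring

/-- The centred increments of the urn. -/
noncomputable def noise (θ : ℝ) (R : Matrix (Fin k) (Fin k) ℝ) (U : ℕ → Ω → Fin k → ℝ)
    (j : Fin k) (n : ℕ) (ω : Ω) : ℝ :=
  U (n + 1) ω j - U n ω j - Matrix.vecMul (urnDrawProb θ U n ω) R j

theorem stronglyMeasurable_noise (h : IsNegReinforcedUrn P R θ U Z) (j : Fin k) (n : ℕ) :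
    StronglyMeasurable[urnFiltration h.measurable_config (n + 1)] (noise θ R U j n) := by
  have h1 := measurable_urnHistory U (le_refl (n + 1))
  have h2 := measurable_urnHistory U n.le_succ
  have h3 : Measurable[urnHistory U (n + 1)] (urnDrawProb θ U n) :=
    (measurable_urnDrawProb U n).mono ((urnFiltration h.measurable_config).mono n.le_succ) le_rfl
  refine Measurable.stronglyMeasurable ?_
  change Measurable[urnHistory U (n + 1)] _
  let _ : MeasurableSpace Ω := urnHistory U (n + 1)
  have h1' := (measurable_pi_apply j).comp h1
  have h2' := (measurable_pi_apply j).comp h2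
  refine (h1'.sub h2').sub ?_
  simp only [Matrix.vecMul, dotProduct]
  exact Finset.measurable_fun_sum _ fun i _ => ((measurable_pi_apply i).comp h3).mul_const _

theorem abs_noise_le (h : IsNegReinforcedUrn P R θ U Z) (hθ : 1 ≤ θ) (hkθ : 1 < (k : ℝ) * θ)
    (hR : R ∈ Matrix.rowStochastic ℝ (Fin k)) (j : Fin k) (n : ℕ) :
    ∀ᵐ ω ∂P, |noise θ R U j n ω| ≤ 1 := by
  filter_upwards [h.ae_config hR, h.step_apply n] with ω hc hs
  have hp := urnDrawProb_mem_stdSimplex hθ hkθ (hc n).1 (hc n).2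
  have h0 := Matrix.nonneg_vecMul_of_mem_rowStochastic hR hp.1 j
  have h1 : Matrix.vecMul (urnDrawProb θ U n ω) R j ≤ 1 := by
    rw [← hp.2, ← sum_vecMul_of_mem_rowStochastic hR]
    exact Finset.single_le_sum (f := fun j => Matrix.vecMul (urnDrawProb θ U n ω) R j)
      (fun j _ => Matrix.nonneg_vecMul_of_mem_rowStochastic hR hp.1 j) (Finset.mem_univ j)
  have h2 := hR.1 (Z n ω) j
  have h3 := Matrix.le_one_of_mem_rowStochastic hR (i := Z n ω) (j := j)
  rw [noise, hs, abs_le]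
  constructor <;> linarith

theorem condExp_noise [IsProbabilityMeasure P] (h : IsNegReinforcedUrn P R θ U Z) (j : Fin k)
    (n : ℕ) : P[noise θ R U j n | urnFiltration h.measurable_config n] =ᵐ[P] 0 := by
  change P[noise θ R U j n | urnHistory U n] =ᵐ[P] 0
  have hle : urnHistory U n ≤ ‹MeasurableSpace Ω› := (urnFiltration h.measurable_config).le n
  let χ : Fin k → Ω → ℝ := fun i => (Z n ⁻¹' {i}).indicator fun _ => 1
  let p : Fin k → Ω → ℝ := fun i ω => urnDrawProb θ U n ω i
  have hχ : ∀ i, Integrable (χ i) P := fun i =>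
    (integrable_const 1).indicator (h.measurable_draw n (measurableSet_singleton i))
  have hcond : ∀ i, P[χ i | urnHistory U n] =ᵐ[P] p i := h.draw n
  have hp : ∀ i, Integrable (p i) P := fun i => integrable_condExp.congr (hcond i)
  have hpm : ∀ i, StronglyMeasurable[urnHistory U n] (p i) := fun i =>
    ((measurable_pi_apply i).comp (measurable_urnDrawProb U n)).stronglyMeasurable
  -- The increment is the row of R at the drawn colour, so the noise is a fixed combination of
  -- centred draw indicators.
  have hnoise : noise θ R U j n =ᵐ[P] ∑ i, R i j • (χ i - p i) := by
    filter_upwards [h.step_apply n] with ω hs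
    have h1 : ∑ i, R i j * χ i ω = R (Z n ω) j := by
      classical simp [χ, Set.indicator_apply]
    simp only [noise, hs, Matrix.vecMul, dotProduct, Finset.sum_apply, Pi.smul_apply,
      Pi.sub_apply, smul_eq_mul, mul_sub, Finset.sum_sub_distrib, h1, p]
    simp [mul_comm]
  refine (condExp_congr_ae hnoise).trans ?_
  refine (condExp_finsetSum (fun i _ => ((hχ i).sub (hp i)).smul (R i j)) _).trans ?_
  have hi : ∀ i, P[R i j • (χ i - p i) | urnHistory U n] =ᵐ[P] 0 := by
    intro i
    filter_upwards [condExp_smul (μ := P) (R i j) (χ i - p i) (urnHistory U n),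
      condExp_sub (hχ i) (hp i) (urnHistory U n), hcond i] with ω h1 h2 h3
    rw [h1, Pi.smul_apply, h2, Pi.sub_apply, h3,
      condExp_of_stronglyMeasurable hle (hpm i) (hp i)]
    simp
  filter_upwards [ae_all_iff.2 hi] with ω hω
  simp [hω]

theorem tendsto_drawProb [IsProbabilityMeasure P] (h : IsNegReinforcedUrn P R θ U Z)
    (hθ : 1 ≤ θ) (hkθ : 1 < (k : ℝ) * θ) (hR : R ∈ Matrix.rowStochastic ℝ (Fin k))
    (hirr : (urnRhat R θ).IsIrreducible) {p : Fin k → ℝ} (hp : ∀ i, 0 < p i)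
    (hpsum : ∑ i, p i = 1) (hstat : Matrix.vecMul p (urnRhat R θ) = p) :
    ∀ᵐ ω ∂P, ∀ j, Tendsto (fun n => urnDrawProb θ U n ω j) atTop (𝓝 (p j)) := by
  have hκ : (k : ℝ) * θ - 1 ≠ 0 := by linarith
  have ha : Summable fun n : ℕ => (1 / ((n : ℝ) + 2)) ^ 2 := by
    have h1 := (summable_nat_add_iff 2).2 (Real.summable_one_div_nat_pow.2 one_lt_two)
    simpa using h1
  have hY := fun j => ae_exists_tendsto_sum_of_martingale_diff
    (h.stronglyMeasurable_noise j) (h.abs_noise_le hθ hkθ hR j) (h.condExp_noise j) ha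
  filter_upwards [ae_all_iff.2 hY, h.ae_config hR] with ω hω hc
  choose l hl using hω
  let S : ℕ → Fin k → ℝ := fun n j =>
    ∑ m ∈ Finset.range n, 1 / ((m : ℝ) + 2) * noise θ R U j m ω
  have hsimp := fun n => urnDrawProb_mem_stdSimplex hθ hkθ (hc n).1 (hc n).2
  refine tendsto_stationary_of_recursion (urnRhat_mem_rowStochastic hkθ hR hirr) hirr hp hpsum
    hstat (C := 1)
    -- Adding S/κ cancels the noise term -ξ/(κ(n+2)); subtracting the limit l makes x - b tend to
    -- zero.
    (b := fun n j => urnDrawProb θ U n ω j + (S n j - l j) / ((k : ℝ) * θ - 1))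
    (fun n i => ?_) (fun n => (hsimp n).2) (fun i => ?_) fun n i => ?_
  · rw [abs_of_nonneg ((hsimp n).1 i), ← (hsimp n).2]
    exact Finset.single_le_sum (fun j _ => (hsimp n).1 j) (Finset.mem_univ i)
  · have h1 : Tendsto (fun n => -((S n i - l i) / ((k : ℝ) * θ - 1))) atTop (𝓝 0) := by
      have h0 : Tendsto (fun n => S n i) atTop (𝓝 (l i)) := hl i
      simpa using ((h0.sub_const (l i)).div_const ((k : ℝ) * θ - 1)).neg
    refine h1.congr fun n => ?_
    ring
  · have hS : S (n + 1) i = S n i + 1 / ((n : ℝ) + 2) * noise θ R U i n ω :=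
      Finset.sum_range_succ _ _
    have hn1 : (n : ℝ) + 1 ≠ 0 := by positivity
    have hn2 : (n : ℝ) + 2 ≠ 0 := by positivity
    rw [hS, vecMul_urnRhat hR, (hsimp n).2, noise, urnDrawProb_eq (hc (n + 1)).2,
      urnDrawProb_eq (hc n).2]
    push_cast
    have h2 : (n : ℝ) + 1 + 1 = n + 2 := by ring
    rw [h2]
    field_simp
    ring

end IsNegReinforcedUrn

end Urn

/-! ### The main theorem. -/

theorem mainTheorem1 (k : ℕ) (θ : ℝ) (hθ : 1 ≤ θ) (hkθ : 1 < (k : ℝ) * θ)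
    (R : Matrix (Fin k) (Fin k) ℝ) (hR : R ∈ Matrix.rowStochastic ℝ (Fin k))
    (hirr : (urnRhat R θ).IsIrreducible) :
    ∃ μ : Fin k → ℝ,
      (Matrix.vecMul (θ • (1 : Fin k → ℝ) - μ) R = ((k : ℝ) * θ - 1) • μ ∧
        ∀ μ' : Fin k → ℝ,
          Matrix.vecMul (θ • (1 : Fin k → ℝ) - μ') R = ((k : ℝ) * θ - 1) • μ' → μ' = μ) ∧
      (∀ (Ω : Type*) [MeasurableSpace Ω] (P : Measure Ω) [IsProbabilityMeasure P]
        (U : ℕ → Ω → Fin k → ℝ) (Z : ℕ → Ω → Fin k),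
        IsNegReinforcedUrn P R θ U Z →
          ∀ j : Fin k, ∀ᵐ ω ∂P,
            Tendsto (fun n : ℕ => U n ω j / ((n : ℝ) + 1)) atTop (𝓝 (μ j))) ∧
      ((∀ j : Fin k, μ j = 1 / (k : ℝ)) ↔ R ∈ doublyStochastic ℝ (Fin k)) := by
  have hκ : (k : ℝ) * θ - 1 ≠ 0 := by linarith
  have hk : (k : ℝ) ≠ 0 := by
    intro h0
    rw [h0, zero_mul] at hkθ
    linarith
  have : NeZero k := ⟨fun h0 => hk (by rw [h0, Nat.cast_zero])⟩
  have hP := urnRhat_mem_rowStochastic hkθ hR hirr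
  obtain ⟨p, hp0, hpsum, hstat⟩ := exists_stationary_of_mem_rowStochastic hP
  have hp := pos_of_stationary hirr hp0 hpsum hstat
  let μ : Fin k → ℝ := fun j => θ - ((k : ℝ) * θ - 1) * p j
  have hμ := urn_equation_of_stationary hkθ hR hpsum hstat (μ := μ) fun _ => rfl
  have huniq : ∀ μ' : Fin k → ℝ,
      Matrix.vecMul (θ • (1 : Fin k → ℝ) - μ') R = ((k : ℝ) * θ - 1) • μ' → μ' = μ := by
    intro μ' h
    obtain ⟨h1, h2⟩ := stationary_of_urn_equation hkθ hR h
      (x := fun j => (θ - μ' j) / ((k : ℝ) * θ - 1)) fun _ => rfl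
    have h3 := eq_of_stationary hP hirr hp hstat h2 (h1.trans hpsum.symm)
    ext j
    simp only [μ, ← h3, mul_div_cancel₀ _ hκ]
    ring
  refine ⟨μ, ⟨hμ, huniq⟩, ?_, ?_, ?_⟩
  · intro Ω _ P _ U Z h j
    filter_upwards [h.tendsto_drawProb hθ hkθ hR hirr hp hpsum hstat, h.ae_config hR]
      with ω hω hc
    refine (((hω j).const_mul ((k : ℝ) * θ - 1)).const_sub θ).congr fun n => ?_
    rw [urnDrawProb_eq (hc n).2, mul_div_cancel₀ _ hκ]
    ring
  · intro h
    refine mem_doublyStochastic_iff_sum.2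
      ⟨hR.1, Matrix.sum_row_of_mem_rowStochastic hR, fun j => ?_⟩
    have h1 := congrFun hμ j
    simp only [Matrix.vecMul, dotProduct, Pi.sub_apply, Pi.smul_apply, Pi.one_apply, h,
      smul_eq_mul, mul_one, ← Finset.mul_sum] at h1
    -- For uniform μ the equation reads (θ - 1/k) · (column sum) = κ/k = θ - 1/k, with a nonzero
    -- factor to cancel.
    have h2 : ((k : ℝ) * θ - 1) * (1 / k) = θ - 1 / k := by
      field_simp
    have h3 : θ - 1 / (k : ℝ) ≠ 0 := by
      rw [← h2]
      exact mul_ne_zero hκ (one_div_ne_zero hk)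
    rw [h2] at h1
    exact mul_left_cancel₀ h3 (by rw [h1, mul_one])
  · intro h j
    have hcol := (mem_doublyStochastic_iff_sum.1 h).2.2
    -- When all column sums are 1, the uniform vector solves the equation, and uniqueness identifies
    -- it with μ.
    refine (congrFun (huniq (fun _ => 1 / (k : ℝ)) ?_) j).symm
    ext i
    simp only [Matrix.vecMul, dotProduct, Pi.sub_apply, Pi.smul_apply, Pi.one_apply,
      smul_eq_mul, mul_one, ← Finset.mul_sum, hcol]
    field_simp
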